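/- Let $0 \le M \le n$ be integers and let $\lambda_0 \ge \lambda_1 \ge \dots \ge \lambda_M \ge 0 > \lambda_{M+1} \ge \dots \ge \lambda_n$ be real numbers (if $M = n$ there are no negative numbers in the list). Suppose that there is a partition $\Lambda_1 \cup \Lambda_2 \cup \dots \cup \Lambda_S$ of the list $\{\lambda_{M+1}, \dots, \lambda_n\}$ (repeated values counted with multiplicity; $S = 0$ if $M = n$) such that $|\Lambda_j|$ is odd for $j = 1, \dots, \min\{M,S\}$ and such that the sums $T_k = \sum_{\lambda_i \in \Lambda_k} \lambda_i$ satisfy $T_S \ge T_{S-1} \ge \dots \ge T_1$. Put $$K = \{\, i \in \{1, \dots, \min\{M,S\}\} : \lambda_i + T_i < 0 \,\},$$ and suppose that (1) $\displaystyle \lambda_0 + \sum_{i \in K,\, i < k} (\lambda_i + T_i) + T_k \ge 0$ for all $k \in K$, and (2) $\displaystyle \lambda_0 + \sum_{i \in K} (\lambda_i + T_i) + \sum_{j=M+1}^{S} T_j \ge 0$ (the last sum being $0$ if $S \le M$). Then there is an $(n+1) \times (n+1)$ real matrix, entrywise nonnegative and bisymmetric (that is, symmetric with respect to both the main diagonal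 and the anti-diagonal), whose eigenvalues, counted with multiplicity, are $\lambda_0, \lambda_1, \dots, \lambda_n$. -/

import Mathlib

/-- A square matrix is persymmetric if it is symmetric with respect to the anti-diagonal. -/
def IsPersymmetric {m : ℕ} (Q : Matrix (Fin m) (Fin m) ℝ) : Prop :=
  ∀ i j, Q (Fin.rev j) (Fin.rev i) = Q i j

/-- A bisymmetric matrix: symmetric with respect to both diagonals. -/
def IsBisymmetric {m : ℕ} (Q : Matrix (Fin m) (Fin m) ℝ) : Prop :=
  Q.IsSymm ∧ IsPersymmetric Q

/-- An entrywise nonnegative matrix. -/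
def IsNonnegMatrix {m : ℕ} (Q : Matrix (Fin m) (Fin m) ℝ) : Prop :=
  ∀ i j, 0 ≤ Q i j

/-- `Λ 1, …, Λ S` is a partition of the finite set `I` into `S` (nonempty) blocks. Blocks consist of
indices, so that repeated values in a list of numbers are counted with multiplicity. -/
structure IsIndexedPartition (S : ℕ) (Λ : ℕ → Finset ℕ) (I : Finset ℕ) : Prop where
  nonempty : ∀ j ∈ Finset.Icc 1 S, (Λ j).Nonempty
  disjoint : ∀ j ∈ Finset.Icc 1 S, ∀ k ∈ Finset.Icc 1 S, j ≠ k → Disjoint (Λ j) (Λ k)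
  union : (Finset.Icc 1 S).biUnion Λ = I

/-- The block sum `T k`, the sum of the numbers `lam i` over the indices `i` in the block `Λ k`. -/
def blockSum (lam : ℕ → ℝ) (Λ : ℕ → Finset ℕ) (k : ℕ) : ℝ :=
  ∑ i ∈ Λ k, lam i

/-- The set `K` of the indices `i` in `{1, …, min M S}` with `lam i + T i < 0`. -/
noncomputable def kelloggSet (lam : ℕ → ℝ) (Λ : ℕ → Finset ℕ) (M S : ℕ) : Finset ℕ :=
  (Finset.Icc 1 (min M S)).filter (fun i => lam i + blockSum lam Λ i < 0)

/-!
The matrix is built from the inside out by a bisymmetric form of Fiedler's gluing. Let `A` and `B` be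
symmetric with unit eigenvectors `u`, `v` for `α`, `β`. In the block matrix with diagonal blocks `A`, `B` and
off-diagonal blocks `ρ u vᵀ`, `ρ v uᵀ`, the eigenvalues `α`, `β` are replaced by those of the quotient
`!![α, ρ; ρ, β]`, and the other eigenvalues stay (`charpoly_fromBlocks_vecMulVec`). If `A` and `B` are
bisymmetric, `u` and `v` are invariant under reversal, and `A` has even order, then placing `B` between the
two halves of `A` keeps the matrix bisymmetric. For `d ≤ α ≤ c` and `β = c + d - α` the number `ρ` can be
chosen so that the quotient has eigenvalues `c`, `d` and a nonnegative eigenvector for `c`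
(`PerronRealizable.glue`).

Gluing matrices of order two gives the realization of one nonnegative number and nonpositive ones whose total
is nonnegative, in every order (`perronRealizable_of_nonpos`). Let `T k` be the sum over the block `Λ k`. For
`k ≤ min M S` the block has odd size, so that it has, together with one nonnegative number `α`, a realization
of even order, which is glued around what has been built. If `lam k + T k ≥ 0`, then `α = lam k` and the gluing
is a direct sum. Otherwise `α = -T k`, and a current eigenvalue `c + lam k + T k` becomes the pair `c`, `lam k`;
the inequality `lam k ≤ -T k ≤ c` that this needs is exactly the hypothesis for `k`
(`PerronRealizable.glue_block`). The innermost matrix realizes the numbers or blocks that have no partner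
(`perronRealizable_unpaired`).
-/

open Polynomial Matrix

/-! ### Eigenvalues of Fiedler's gluing -/

/-- A rank-one change along a unit eigenvector only moves the corresponding eigenvalue. -/
lemma det_sub_smul_vecMulVec_of_mulVec_eq {ι : Type*} [Fintype ι] [DecidableEq ι]
    {B : Matrix ι ι ℝ} {v : ι → ℝ} {b s : ℝ} (hb : b ≠ 0) (hv : v ⬝ᵥ v = 1)
    (hB : B *ᵥ v = b • v) :
    (B - s • vecMulVec v v).det = B.det * (1 - s / b) := by
  have h : B - s • vecMulVec v v = B * (1 + vecMulVec (-(s / b) • v) v) := by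
    rw [mul_add, mul_one, mul_vecMulVec, mulVec_smul, hB, smul_smul, smul_vecMulVec]
    rw [neg_mul, div_mul_cancel₀ _ hb, neg_smul, sub_eq_add_neg]
  rw [h, det_mul, vecMulVec_eq Unit, det_one_add_replicateCol_mul_replicateRow, dotProduct_smul, hv]
  simp [sub_eq_add_neg]

lemma charpoly_fromBlocks_vecMulVec {m n : Type*} [Fintype m] [DecidableEq m] [Fintype n]
    [DecidableEq n] {A : Matrix m m ℝ} {B : Matrix n n ℝ} {u : m → ℝ} {v : n → ℝ}
    {α β c d ρ : ℝ} {p q : ℝ[X]}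
    (hA : A.charpoly = (X - C α) * p) (hu : u ⬝ᵥ u = 1) (hAu : A *ᵥ u = α • u)
    (hB : B.charpoly = (X - C β) * q) (hv : v ⬝ᵥ v = 1) (hBv : B *ᵥ v = β • v)
    (hsum : α + β = c + d) (hprod : α * β - ρ ^ 2 = c * d) :
    (fromBlocks A (ρ • vecMulVec u v) (ρ • vecMulVec v u) B).charpoly =
      (X - C c) * ((X - C d) * (p * q)) := by
  have hne : A.charpoly * B.charpoly ≠ 0 :=
    mul_ne_zero A.charpoly_monic.ne_zero B.charpoly_monic.ne_zero
  -- It suffices to compare values off the spectra of `A` and `B`, where the Schur complement exists.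
  apply eq_of_infinite_eval_eq
  refine Set.Infinite.mono ?_ (finite_setOfPred_isRoot hne).infinite_compl
  intro t ht
  have ht' : (A.charpoly.eval t) * (B.charpoly.eval t) ≠ 0 := by
    simpa [IsRoot.def] using ht
  obtain ⟨hAt, hBt⟩ := mul_ne_zero_iff.mp ht'
  have htα : t - α ≠ 0 := by
    intro h; apply hAt; simp [hA, h]
  have htβ : t - β ≠ 0 := by
    intro h; apply hBt; simp [hB, h]
  have hdA : (scalar m t - A).det = (t - α) * p.eval t := by
    rw [← eval_charpoly, hA]; simp
  have hdB : (scalar n t - B).det = (t - β) * q.eval t := by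
    rw [← eval_charpoly, hB]; simp
  have hunit : IsUnit (scalar m t - A).det := by
    rw [← eval_charpoly]; exact hAt.isUnit
  let _ := invertibleOfIsUnitDet _ hunit
  have hsc : scalar (m ⊕ n) t - fromBlocks A (ρ • vecMulVec u v) (ρ • vecMulVec v u) B =
      fromBlocks (scalar m t - A) (-(ρ • vecMulVec u v)) (-(ρ • vecMulVec v u))
        (scalar n t - B) := by
    ext (i | i) (j | j) <;> simp [scalar_apply, diagonal_apply]
  have hinv : ⅟(scalar m t - A) *ᵥ u = (t - α)⁻¹ • u := by
    have h1 : (scalar m t - A) *ᵥ u = (t - α) • u := by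
      rw [sub_mulVec, hAu, sub_smul]; congr 1
      ext i; simp [scalar_apply, mulVec_diagonal]
    have h2 : u = (t - α) • (⅟(scalar m t - A) *ᵥ u) := by
      rw [← mulVec_smul, ← h1, mulVec_mulVec, invOf_mul_self, one_mulVec]
    nth_rewrite 2 [h2]
    rw [smul_smul, inv_mul_cancel₀ htα, one_smul]
  have hBv' : (scalar n t - B) *ᵥ v = (t - β) • v := by
    rw [sub_mulVec, hBv, sub_smul]; congr 1
    ext i; simp [scalar_apply, mulVec_diagonal]
  have hschur : -(ρ • vecMulVec v u) * ⅟(scalar m t - A) * -(ρ • vecMulVec u v) =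
      (ρ ^ 2 / (t - α)) • vecMulVec v v := by
    rw [Matrix.neg_mul, Matrix.neg_mul, Matrix.mul_neg, neg_neg, smul_mul, smul_mul, Matrix.mul_smul,
      Matrix.mul_assoc, mul_vecMulVec, hinv, smul_vecMulVec, Matrix.mul_smul,
      vecMulVec_mul_vecMulVec, hu, one_smul, smul_smul, smul_smul]
    congr 1; field_simp
  change eval t _ = eval t _
  rw [eval_charpoly, hsc, det_fromBlocks₁₁, hschur,
    det_sub_smul_vecMulVec_of_mulVec_eq htβ hv hBv', hdA, hdB]
  have hcd : (t - α) * (t - β) - ρ ^ 2 = (t - c) * (t - d) := by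
    linear_combination (-t) * hsum + hprod
  simp only [eval_mul, eval_sub, eval_X, eval_C]
  field_simp
  linear_combination (p.eval t * q.eval t) * hcd

/-! ### Bisymmetric gluing -/

/-- The equivalence that puts `Fin b` in the middle of `Fin (2 * a)`. -/
lemma exists_finSumEquiv_rev (a b : ℕ) : ∃ e : Fin (2 * a) ⊕ Fin b ≃ Fin (2 * a + b),
    ∀ x, e (Sum.map Fin.rev Fin.rev x) = Fin.rev (e x) := by
  let f : Fin (2 * a) ⊕ Fin b → Fin (2 * a + b) :=
    Sum.elim (fun i => ⟨if i.1 < a then i.1 else i.1 + b, by split_ifs <;> omega⟩)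
      (fun j => ⟨a + j.1, by omega⟩)
  have hinj : Function.Injective f := by
    rintro (i | i) (j | j) h <;> simp only [f, Sum.elim_inl, Sum.elim_inr, Fin.mk.injEq] at h
    · congr 1; ext; split_ifs at h <;> omega
    · split_ifs at h <;> omega
    · split_ifs at h <;> omega
    · congr 1; ext; omega
  refine ⟨Equiv.ofBijective f ((Fintype.bijective_iff_injective_and_card f).2 ⟨hinj, by simp⟩), ?_⟩
  rintro (i | i) <;> ext <;> simp only [Equiv.ofBijective_apply, f, Sum.map_inl, Sum.map_inr,
    Sum.elim_inl, Sum.elim_inr, Fin.val_rev]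
  · split_ifs <;> omega
  · omega

/-- `PerronRealizable m c p`: some nonnegative bisymmetric matrix of order `m` has characteristic
polynomial `(X - c) * p` and a nonnegative unit eigenvector for `c` that is invariant under reversal
of the coordinates. -/
def PerronRealizable (m : ℕ) (c : ℝ) (p : ℝ[X]) : Prop :=
  ∃ (Q : Matrix (Fin m) (Fin m) ℝ) (v : Fin m → ℝ), IsNonnegMatrix Q ∧ IsBisymmetric Q ∧
    Q.charpoly = (X - C c) * p ∧ (∀ i, 0 ≤ v i) ∧ (∀ i, v (Fin.rev i) = v i) ∧
    v ⬝ᵥ v = 1 ∧ Q *ᵥ v = c • v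

/-- Here `(x, y)` is a nonnegative unit eigenvector for `c` of the quotient `!![α, ρ; ρ, β]`; it makes
`(x u, y v)` an eigenvector of the glued matrix. -/
lemma PerronRealizable.glue_of_eigenvector {a b : ℕ} {α β c d ρ x y : ℝ} {p q : ℝ[X]}
    (hA : PerronRealizable (2 * a) α p) (hB : PerronRealizable b β q)
    (hρ : 0 ≤ ρ) (hx : 0 ≤ x) (hy : 0 ≤ y) (hxy : x ^ 2 + y ^ 2 = 1)
    (h1 : α * x + ρ * y = c * x) (h2 : ρ * x + β * y = c * y)
    (hsum : α + β = c + d) (hprod : α * β - ρ ^ 2 = c * d) :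
    PerronRealizable (2 * a + b) c ((X - C d) * (p * q)) := by
  obtain ⟨A, u, hA0, ⟨hAs, hAp⟩, hAc, hu0, hur, hu, hAu⟩ := hA
  obtain ⟨B, v, hB0, ⟨hBs, hBp⟩, hBc, hv0, hvr, hv, hBv⟩ := hB
  obtain ⟨e, he⟩ := exists_finSumEquiv_rev a b
  have he' : ∀ i, e.symm (Fin.rev i) = Sum.map Fin.rev Fin.rev (e.symm i) := by
    intro i; rw [Equiv.symm_apply_eq, he, Equiv.apply_symm_apply]
  set F := fromBlocks A (ρ • vecMulVec u v) (ρ • vecMulVec v u) B with hF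
  set w : Fin (2 * a) ⊕ Fin b → ℝ := Sum.elim (x • u) (y • v) with hw
  have hFw : F *ᵥ w = c • w := by
    rw [hF, hw, fromBlocks_mulVec]
    simp only [Function.comp_def, Sum.elim_inl, Sum.elim_inr]
    have e1 : (fun i => (x • u) i) = x • u := rfl
    have e2 : (fun i => (y • v) i) = y • v := rfl
    rw [e1, e2, mulVec_smul, mulVec_smul, mulVec_smul, mulVec_smul, smul_mulVec, smul_mulVec,
      vecMulVec_mulVec, vecMulVec_mulVec, hu, hv, hAu, hBv]
    ext (i | i)
    · simp only [Sum.elim_inl, Pi.add_apply, Pi.smul_apply, smul_eq_mul, MulOpposite.op_one, one_smul]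
      linear_combination u i * h1
    · simp only [Sum.elim_inr, Pi.add_apply, Pi.smul_apply, smul_eq_mul, MulOpposite.op_one, one_smul]
      linear_combination v i * h2
  refine ⟨reindex e e F, w ∘ e.symm, ?_, ⟨?_, ?_⟩, ?_, ?_, ?_, ?_, ?_⟩
  · intro i j
    rw [reindex_apply, submatrix_apply]
    rcases e.symm i with i | i <;> rcases e.symm j with j | j
    · exact hA0 i j
    · exact mul_nonneg hρ (mul_nonneg (hu0 _) (hv0 _))
    · exact mul_nonneg hρ (mul_nonneg (hv0 _) (hu0 _))
    · exact hB0 i j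
  · have hFs : F.IsSymm := by
      refine IsSymm.fromBlocks hAs ?_ hBs
      rw [transpose_smul, transpose_vecMulVec]
    exact hFs.submatrix _
  · intro i j
    simp only [reindex_apply, submatrix_apply, he']
    rcases e.symm i with i | i <;> rcases e.symm j with j | j
    · exact hAp i j
    · simp [hF, vecMulVec_apply, hur, hvr, mul_comm]
    · simp [hF, vecMulVec_apply, hur, hvr, mul_comm]
    · exact hBp i j
  · rw [charpoly_reindex, hF]
    exact charpoly_fromBlocks_vecMulVec hAc hu hAu hBc hv hBv hsum hprod
  · intro i
    simp only [Function.comp_apply]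
    rcases e.symm i with i | i
    · exact mul_nonneg hx (hu0 i)
    · exact mul_nonneg hy (hv0 i)
  · intro i
    simp only [Function.comp_apply, he']
    rcases e.symm i with i | i
    · simp [hw, hur]
    · simp [hw, hvr]
  · rw [comp_equiv_dotProduct_comp_equiv, hw, sumElim_dotProduct_sumElim, smul_dotProduct,
      dotProduct_smul, smul_dotProduct, dotProduct_smul, hu, hv]
    simp only [smul_eq_mul]
    linear_combination hxy
  · rw [reindex_apply, submatrix_mulVec_equiv, Function.comp_assoc, Equiv.symm_symm,
      Equiv.symm_comp_self, Function.comp_id, hFw]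
    rfl

/-- Gluing with prescribed eigenvalues `d ≤ c` of the quotient. The Perron vector of the `2 × 2`
quotient is `(√(α - d), √(c - α))` up to scaling. -/
lemma PerronRealizable.glue {a b : ℕ} {α β c d : ℝ} {p q : ℝ[X]}
    (hA : PerronRealizable (2 * a) α p) (hB : PerronRealizable b β q)
    (hsum : α + β = c + d) (hd : d ≤ α) (hc : α ≤ c) :
    PerronRealizable (2 * a + b) c ((X - C d) * (p * q)) := by
  obtain rfl : β = c + d - α := by linarith
  rcases (hd.trans hc).eq_or_lt with rfl | hlt
  · obtain rfl : d = α := le_antisymm hd hc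
    exact hA.glue_of_eigenvector hB (ρ := 0) (x := 1) (y := 0) le_rfl zero_le_one le_rfl
      (by norm_num) (by ring) (by ring) hsum (by ring)
  · have hpos : 0 < c - d := sub_pos.2 hlt
    obtain ⟨r, hr, hr2⟩ : ∃ r, 0 ≤ r ∧ r ^ 2 = α - d :=
      ⟨√(α - d), Real.sqrt_nonneg _, Real.sq_sqrt (by linarith)⟩
    obtain ⟨s, hs, hs2⟩ : ∃ s, 0 ≤ s ∧ s ^ 2 = c - α :=
      ⟨√(c - α), Real.sqrt_nonneg _, Real.sq_sqrt (by linarith)⟩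
    obtain ⟨k, hk, hk2⟩ : ∃ k, 0 ≤ k ∧ k ^ 2 * (c - d) = 1 :=
      ⟨√(c - d)⁻¹, Real.sqrt_nonneg _, by
        rw [Real.sq_sqrt (inv_nonneg.2 hpos.le), inv_mul_cancel₀ hpos.ne']⟩
    refine hA.glue_of_eigenvector hB (ρ := r * s) (x := k * r) (y := k * s) (by positivity)
      (by positivity) (by positivity) ?_ ?_ ?_ hsum ?_
    · linear_combination k ^ 2 * hr2 + k ^ 2 * hs2 + hk2
    · linear_combination k * r * hs2
    · linear_combination k * s * hr2
    · rw [mul_pow, hr2, hs2]; ring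

/-! ### Realizations from matrices of order two -/

lemma perronRealizable_one {c : ℝ} (hc : 0 ≤ c) : PerronRealizable 1 c 1 := by
  refine ⟨of fun _ _ => c, fun _ => 1, fun _ _ => hc, ⟨rfl, fun _ _ => rfl⟩, ?_, fun _ => zero_le_one,
    fun _ => rfl, ?_, ?_⟩
  · simp [Matrix.charpoly, charmatrix_apply_eq]
  · simp [dotProduct]
  · ext i; simp [mulVec, dotProduct]

lemma perronRealizable_two {c d : ℝ} (h1 : -c ≤ d) (h2 : d ≤ c) :
    PerronRealizable 2 c (X - C d) := by
  refine ⟨!![(c + d) / 2, (c - d) / 2; (c - d) / 2, (c + d) / 2], fun _ => √(1 / 2), ?_,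
    ⟨?_, ?_⟩, ?_, fun _ => Real.sqrt_nonneg _, fun _ => rfl, ?_, ?_⟩
  · intro i j; fin_cases i <;> fin_cases j <;> simp <;> linarith
  · ext i j; fin_cases i <;> fin_cases j <;> simp
  · intro i j; fin_cases i <;> fin_cases j <;> simp [Fin.rev]
  · rw [charpoly_fin_two, trace_fin_two_of, det_fin_two_of]
    have e1 : (c + d) / 2 + (c + d) / 2 = c + d := by ring
    have e2 : (c + d) / 2 * ((c + d) / 2) - (c - d) / 2 * ((c - d) / 2) = c * d := by ring
    rw [e1, e2, C_add, C_mul]; ring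
  · simp only [dotProduct, Fin.sum_univ_two, Real.mul_self_sqrt (by norm_num : (0 : ℝ) ≤ 1 / 2)]
    norm_num
  · ext i; fin_cases i <;> simp [mulVec, dotProduct] <;> ring

/-- Two numbers are split off at a time: around a matrix for `c + x + y` and the rest one glues a `2 × 2`
matrix with eigenvalues `-x, x`, with `c, y` the eigenvalues of the quotient. -/
lemma perronRealizable_of_nonpos (c : ℝ) : ∀ l : List ℝ, (∀ x ∈ l, x ≤ 0) → 0 ≤ c + l.sum →
    PerronRealizable (l.length + 1) c (l.map fun x => X - C x).prod
  | [], _, hc => by simpa using perronRealizable_one (by simpa using hc)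
  | [x], hl, hc => by
    have hx : x ≤ 0 := hl x (by simp)
    simp only [List.sum_cons, List.sum_nil, add_zero] at hc
    simpa using perronRealizable_two (c := c) (d := x) (by linarith) (by linarith)
  | x :: y :: l, hl, hc => by
    have hx : x ≤ 0 := hl x (by simp)
    have hy : y ≤ 0 := hl y (by simp)
    have hl' : ∀ z ∈ l, z ≤ 0 := fun z hz => hl z (by simp [hz])
    have hs : l.sum ≤ 0 := by
      simpa using List.sum_le_card_nsmul l 0 hl'
    simp only [List.sum_cons] at hc
    have hB := perronRealizable_of_nonpos (c + x + y) l hl' (by linarith)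
    have hA : PerronRealizable (2 * 1) (-x) (X - C x) :=
      perronRealizable_two (by linarith) (by linarith)
    have h := hA.glue hB (c := c) (d := y) (by ring) (by linarith) (by linarith)
    rw [show (x :: y :: l).length + 1 = 2 * 1 + (l.length + 1) by simp; ring,
      show ((x :: y :: l).map fun x => X - C x).prod =
        (X - C y) * ((X - C x) * (l.map fun x => X - C x).prod) by simp; ring]
    exact h

lemma perronRealizable_of_nonneg (c : ℝ) (hc : 0 ≤ c) : ∀ l : List ℝ, (∀ x ∈ l, 0 ≤ x) →
    (∀ x ∈ l, x ≤ c) → PerronRealizable (l.length + 1) c (l.map fun x => X - C x).prod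
  | [], _, _ => by simpa using perronRealizable_one hc
  | [x], hl, hlc => by
    have hx : 0 ≤ x := hl x (by simp)
    simpa using perronRealizable_two (c := c) (d := x) (by linarith) (hlc x (by simp))
  | x :: y :: l, hl, hlc => by
    have hB := perronRealizable_of_nonneg c hc l (fun z hz => hl z (by simp [hz]))
      (fun z hz => hlc z (by simp [hz]))
    have hx : 0 ≤ x := hl x (by simp)
    have hy : 0 ≤ y := hl y (by simp)
    have key : ∀ z w : ℝ, 0 ≤ w → w ≤ z → z ≤ c → PerronRealizable (2 * 1 + (l.length + 1)) c
        ((X - C z) * ((X - C w) * (l.map fun x => X - C x).prod)) := fun z w hw hwz hz =>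
      PerronRealizable.glue (perronRealizable_two (by linarith) hwz) hB (add_comm z c) le_rfl hz
    rw [show (x :: y :: l).length + 1 = 2 * 1 + (l.length + 1) by simp; ring]
    rcases le_total x y with hxy | hxy
    · convert key y x hx hxy (hlc y (by simp)) using 1
      simp; ring
    · convert key x y hy hxy (hlc x (by simp)) using 1
      simp

lemma perronRealizable_finset_of_nonpos {c : ℝ} {s : Finset ℕ} {f : ℕ → ℝ}
    (hf : ∀ i ∈ s, f i ≤ 0) (hc : 0 ≤ c + ∑ i ∈ s, f i) :
    PerronRealizable (s.card + 1) c (∏ i ∈ s, (X - C (f i))) := by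
  have h := perronRealizable_of_nonpos c (s.toList.map f) (by simpa using hf) (by simpa using hc)
  simpa [Function.comp_def] using h

lemma perronRealizable_finset_of_nonneg {c : ℝ} {s : Finset ℕ} {f : ℕ → ℝ} (hc : 0 ≤ c)
    (hf : ∀ i ∈ s, 0 ≤ f i) (hfc : ∀ i ∈ s, f i ≤ c) :
    PerronRealizable (s.card + 1) c (∏ i ∈ s, (X - C (f i))) := by
  have h := perronRealizable_of_nonneg c hc (s.toList.map f) (by simpa using hf) (by simpa using hfc)
  simpa [Function.comp_def] using h

/-! ### The pairing of nonnegative numbers with blocks -/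

/-- The Perron eigenvalue that is left once the pairs `(lam i, blockSum lam Λ i)` with `i < k` and
`i` in the Kellogg set have been absorbed. -/
noncomputable def kelloggPerron (lam : ℕ → ℝ) (Λ : ℕ → Finset ℕ) (M S k : ℕ) : ℝ :=
  lam 0 + ∑ i ∈ (kelloggSet lam Λ M S).filter (fun i => i < k), (lam i + blockSum lam Λ i)

lemma kelloggPerron_succ_of_mem {lam : ℕ → ℝ} {Λ : ℕ → Finset ℕ} {M S k : ℕ}
    (hk : k ∈ kelloggSet lam Λ M S) :
    kelloggPerron lam Λ M S (k + 1) =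
      kelloggPerron lam Λ M S k + (lam k + blockSum lam Λ k) := by
  have h : (kelloggSet lam Λ M S).filter (fun i => i < k + 1) =
      insert k ((kelloggSet lam Λ M S).filter (fun i => i < k)) := by
    ext i
    simp only [Finset.mem_filter, Finset.mem_insert, Nat.lt_succ_iff_lt_or_eq]
    constructor
    · rintro ⟨h, h' | h'⟩ <;> tauto
    · rintro (rfl | ⟨h, h'⟩) <;> tauto
  rw [kelloggPerron, h, Finset.sum_insert (by simp), kelloggPerron]
  ring

lemma kelloggPerron_succ_of_notMem {lam : ℕ → ℝ} {Λ : ℕ → Finset ℕ} {M S k : ℕ}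
    (hk : k ∉ kelloggSet lam Λ M S) :
    kelloggPerron lam Λ M S (k + 1) = kelloggPerron lam Λ M S k := by
  have h : (kelloggSet lam Λ M S).filter (fun i => i < k + 1) =
      (kelloggSet lam Λ M S).filter (fun i => i < k) := by
    ext i
    simp only [Finset.mem_filter, Nat.lt_succ_iff_lt_or_eq]
    constructor
    · rintro ⟨h, h' | rfl⟩ <;> tauto
    · tauto
  rw [kelloggPerron, h, kelloggPerron]

lemma kelloggPerron_one (lam : ℕ → ℝ) (Λ : ℕ → Finset ℕ) (M S : ℕ) :
    kelloggPerron lam Λ M S 1 = lam 0 := by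
  have h : (kelloggSet lam Λ M S).filter (fun i => i < 1) = ∅ := by
    refine Finset.filter_eq_empty_iff.2 fun i hi => ?_
    exact not_lt.2 (Finset.mem_Icc.1 (Finset.mem_filter.1 hi).1).1
  rw [kelloggPerron, h, Finset.sum_empty, add_zero]

lemma kelloggPerron_min_succ (lam : ℕ → ℝ) (Λ : ℕ → Finset ℕ) (M S : ℕ) :
    kelloggPerron lam Λ M S (min M S + 1) =
      lam 0 + ∑ i ∈ kelloggSet lam Λ M S, (lam i + blockSum lam Λ i) := by
  rw [kelloggPerron, Finset.filter_true_of_mem]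
  intro i hi
  exact Nat.lt_succ_of_le (Finset.mem_Icc.1 (Finset.mem_filter.1 hi).1).2

/-- Each absorption leaves a Perron eigenvalue that still dominates the remaining eigenvalues: for `k` in
the Kellogg set the new value is `lam k` plus the left-hand side of the `k`-th hypothesis. -/
lemma le_kelloggPerron {lam : ℕ → ℝ} {Λ : ℕ → Finset ℕ} {M S : ℕ}
    (hlam : ∀ i j, i ≤ j → j ≤ M → lam j ≤ lam i)
    (h1 : ∀ k ∈ kelloggSet lam Λ M S, 0 ≤ kelloggPerron lam Λ M S k + blockSum lam Λ k)
    {j : ℕ} (hj : j ≤ M) (k : ℕ) (hk : k ≤ j) : lam j ≤ kelloggPerron lam Λ M S (k + 1) := by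
  induction k with
  | zero => rw [kelloggPerron_one]; exact hlam 0 j hk hj
  | succ k ih =>
    by_cases hkK : k + 1 ∈ kelloggSet lam Λ M S
    · rw [kelloggPerron_succ_of_mem hkK]
      linarith [h1 _ hkK, hlam _ _ hk hj]
    · rw [kelloggPerron_succ_of_notMem hkK]
      exact ih (by omega)

/-- One step of the construction: the block `Λ k` with a Perron eigenvalue `α` is glued around the matrix
built so far. For `k` in the Kellogg set `α = -blockSum lam Λ k`, so that the block has trace zero; otherwise
`α = lam k` and the gluing is a direct sum. -/
lemma PerronRealizable.glue_block {lam : ℕ → ℝ} {Λ : ℕ → Finset ℕ} {M S k b : ℕ} {q : ℝ[X]}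
    (hlam : ∀ i j, i ≤ j → j ≤ M → lam j ≤ lam i)
    (h1 : ∀ k ∈ kelloggSet lam Λ M S, 0 ≤ kelloggPerron lam Λ M S k + blockSum lam Λ k)
    (hk : k + 1 ≤ min M S) (hodd : Odd (Λ (k + 1)).card)
    (hneg : ∀ i ∈ Λ (k + 1), lam i < 0)
    (hB : PerronRealizable b (kelloggPerron lam Λ M S (k + 2)) q) :
    ∃ m, PerronRealizable m (kelloggPerron lam Λ M S (k + 1))
      (q * ((X - C (lam (k + 1))) * ∏ i ∈ Λ (k + 1), (X - C (lam i)))) := by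
  obtain ⟨a, ha⟩ : ∃ a, (Λ (k + 1)).card + 1 = 2 * a := by
    obtain ⟨r, hr⟩ := hodd
    exact ⟨r + 1, by omega⟩
  have hA : ∀ α, 0 ≤ α + blockSum lam Λ (k + 1) →
      PerronRealizable (2 * a) α (∏ i ∈ Λ (k + 1), (X - C (lam i))) := fun α hα =>
    ha ▸ perronRealizable_finset_of_nonpos (fun i hi => (hneg i hi).le) hα
  suffices h : ∃ m, PerronRealizable m (kelloggPerron lam Λ M S (k + 1))
      ((X - C (lam (k + 1))) * ((∏ i ∈ Λ (k + 1), (X - C (lam i))) * q)) by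
    convert h using 3
    ring
  by_cases hkK : k + 1 ∈ kelloggSet lam Λ M S
  · have hlt := (Finset.mem_filter.1 hkK).2
    have hge := h1 _ hkK
    rw [kelloggPerron_succ_of_mem hkK] at hB
    exact ⟨_, (hA (-blockSum lam Λ (k + 1)) (by linarith)).glue hB (by ring) (by linarith)
      (by linarith)⟩
  · have hge : 0 ≤ lam (k + 1) + blockSum lam Λ (k + 1) := by
      by_contra! hlt
      exact hkK (Finset.mem_filter.2 ⟨Finset.mem_Icc.2 ⟨by omega, hk⟩, hlt⟩)
    rw [kelloggPerron_succ_of_notMem hkK] at hB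
    exact ⟨_, (hA _ hge).glue hB (add_comm _ _) le_rfl
      (le_kelloggPerron hlam h1 (hk.trans (min_le_left _ _)) k (by omega))⟩

lemma PerronRealizable.glue_blocks {lam : ℕ → ℝ} {Λ : ℕ → Finset ℕ} {M S : ℕ}
    (hlam : ∀ i j, i ≤ j → j ≤ M → lam j ≤ lam i)
    (h1 : ∀ k ∈ kelloggSet lam Λ M S, 0 ≤ kelloggPerron lam Λ M S k + blockSum lam Λ k)
    (hodd : ∀ j ∈ Finset.Icc 1 (min M S), Odd (Λ j).card)
    (hneg : ∀ j ∈ Finset.Icc 1 S, ∀ i ∈ Λ j, lam i < 0) (k : ℕ) (hk : k ≤ min M S)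
    {b : ℕ} {q : ℝ[X]} (hB : PerronRealizable b (kelloggPerron lam Λ M S (k + 1)) q) :
    ∃ m, PerronRealizable m (lam 0)
      (q * ∏ j ∈ Finset.Icc 1 k, ((X - C (lam j)) * ∏ i ∈ Λ j, (X - C (lam i)))) := by
  induction k generalizing b q with
  | zero =>
    rw [kelloggPerron_one] at hB
    exact ⟨b, by simpa using hB⟩
  | succ k ih =>
    obtain ⟨m, hm⟩ := hB.glue_block hlam h1 hk (hodd _ (Finset.mem_Icc.2 ⟨by omega, hk⟩))
      (hneg _ (Finset.mem_Icc.2 ⟨by omega, hk.trans (min_le_right _ _)⟩))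
    obtain ⟨m', hm'⟩ := ih (by omega) hm
    refine ⟨m', ?_⟩
    rwa [Finset.prod_Icc_succ_top (by omega), mul_comm (∏ j ∈ Finset.Icc 1 k, _), ← mul_assoc]

/-- The innermost matrix realizes what is left over after the pairing: the unpaired nonnegative numbers if
`S ≤ M`, the unpaired blocks if `M ≤ S`. -/
lemma perronRealizable_unpaired {lam : ℕ → ℝ} {Λ : ℕ → Finset ℕ} {M S : ℕ}
    (hlam : ∀ i j, i ≤ j → j ≤ M → lam j ≤ lam i) (hnonneg : ∀ i, i ≤ M → 0 ≤ lam i)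
    (h1 : ∀ k ∈ kelloggSet lam Λ M S, 0 ≤ kelloggPerron lam Λ M S k + blockSum lam Λ k)
    (hdisj : ∀ j ∈ Finset.Icc 1 S, ∀ k ∈ Finset.Icc 1 S, j ≠ k → Disjoint (Λ j) (Λ k))
    (hneg : ∀ j ∈ Finset.Icc 1 S, ∀ i ∈ Λ j, lam i < 0)
    (h2 : 0 ≤ kelloggPerron lam Λ M S (min M S + 1) +
      ∑ j ∈ Finset.Icc (M + 1) S, blockSum lam Λ j) :
    ∃ m, PerronRealizable m (kelloggPerron lam Λ M S (min M S + 1))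
      ((∏ i ∈ Finset.Icc (S + 1) M, (X - C (lam i))) *
        ∏ j ∈ Finset.Icc (M + 1) S, ∏ i ∈ Λ j, (X - C (lam i))) := by
  rcases le_total S M with hSM | hMS
  · have hlow : ∀ j ≤ M, S ≤ j → lam j ≤ kelloggPerron lam Λ M S (min M S + 1) := fun j hj hSj =>
      le_kelloggPerron hlam h1 hj _ (by omega)
    rw [Finset.Icc_eq_empty_of_lt (show S < M + 1 by omega), Finset.prod_empty, mul_one]
    refine ⟨_, perronRealizable_finset_of_nonneg ((hnonneg M le_rfl).trans (hlow M le_rfl hSM))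
      (fun i hi => hnonneg i (Finset.mem_Icc.1 hi).2) fun i hi => ?_⟩
    have := Finset.mem_Icc.1 hi
    exact hlow i this.2 (by omega)
  · have hsub : Finset.Icc (M + 1) S ⊆ Finset.Icc 1 S := Finset.Icc_subset_Icc_left (by omega)
    have hd : ((Finset.Icc (M + 1) S : Finset ℕ) : Set ℕ).PairwiseDisjoint Λ :=
      fun j hj k hk hjk => hdisj j (hsub hj) k (hsub hk) hjk
    rw [Finset.Icc_eq_empty_of_lt (show M < S + 1 by omega), Finset.prod_empty, one_mul,
      ← Finset.prod_biUnion hd]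
    refine ⟨_, perronRealizable_finset_of_nonpos (fun i hi => ?_) ?_⟩
    · obtain ⟨j, hj, hi⟩ := Finset.mem_biUnion.1 hi
      exact (hneg j (hsub hj) i hi).le
    · rw [Finset.sum_biUnion hd]
      exact h2

lemma prod_Icc_one_min_mul {R : Type*} [CommMonoid R] (M S : ℕ) (f : ℕ → R) :
    (∏ i ∈ Finset.Icc 1 (min M S), f i) * ∏ i ∈ Finset.Icc (S + 1) M, f i =
      ∏ i ∈ Finset.Icc 1 M, f i := by
  rw [← Finset.prod_union]
  · congr 1
    ext i
    simp only [Finset.mem_union, Finset.mem_Icc]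
    omega
  · rw [Finset.disjoint_left]
    intro i
    simp only [Finset.mem_Icc]
    omega

theorem mainTheorem4 (n M S : ℕ) (hMn : M ≤ n) (lam : ℕ → ℝ)
    (hanti : ∀ i j, i ≤ j → j ≤ n → lam j ≤ lam i)
    (hnonneg : ∀ i, i ≤ M → 0 ≤ lam i)
    (hneg : ∀ i, M < i → i ≤ n → lam i < 0)
    (Λ : ℕ → Finset ℕ)
    (hpart : IsIndexedPartition S Λ (Finset.Icc (M + 1) n))
    (hodd : ∀ j ∈ Finset.Icc 1 (min M S), Odd (Λ j).card)
    (hT : ∀ j k, 1 ≤ j → j ≤ k → k ≤ S → blockSum lam Λ j ≤ blockSum lam Λ k)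
    (h1 : ∀ k ∈ kelloggSet lam Λ M S,
      0 ≤ lam 0
        + ∑ i ∈ (kelloggSet lam Λ M S).filter (fun i => i < k), (lam i + blockSum lam Λ i)
        + blockSum lam Λ k)
    (h2 : 0 ≤ lam 0 + ∑ i ∈ kelloggSet lam Λ M S, (lam i + blockSum lam Λ i)
        + ∑ j ∈ Finset.Icc (M + 1) S, blockSum lam Λ j) :
    ∃ Q : Matrix (Fin (n + 1)) (Fin (n + 1)) ℝ,
      IsNonnegMatrix Q ∧ IsBisymmetric Q ∧
        Q.charpoly = ∏ i ∈ Finset.range (n + 1), (Polynomial.X - Polynomial.C (lam i)) := by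
  have hmem : ∀ j ∈ Finset.Icc 1 S, ∀ i ∈ Λ j, M < i ∧ i ≤ n := by
    intro j hj i hi
    have h : i ∈ Finset.Icc (M + 1) n := hpart.union ▸ Finset.mem_biUnion.2 ⟨j, hj, hi⟩
    simpa [Nat.succ_le_iff] using h
  have hneg' : ∀ j ∈ Finset.Icc 1 S, ∀ i ∈ Λ j, lam i < 0 := fun j hj i hi =>
    hneg i (hmem j hj i hi).1 (hmem j hj i hi).2
  have hlam : ∀ i j, i ≤ j → j ≤ M → lam j ≤ lam i := fun i j hij hj =>
    hanti i j hij (hj.trans hMn)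
  rw [← kelloggPerron_min_succ] at h2
  obtain ⟨b, hb⟩ := perronRealizable_unpaired hlam hnonneg h1 hpart.disjoint hneg' h2
  obtain ⟨m, Q, -, hQ0, hQb, hQc, -⟩ := hb.glue_blocks hlam h1 hodd hneg' _ le_rfl
  have hblocks : ∏ j ∈ Finset.Icc 1 S, ∏ i ∈ Λ j, (X - C (lam i)) =
      ∏ i ∈ Finset.Icc (M + 1) n, (X - C (lam i)) := by
    rw [← hpart.union, Finset.prod_biUnion fun j hj k hk => hpart.disjoint j hj k hk]
  have hchar : Q.charpoly = ∏ i ∈ Finset.range (n + 1), (X - C (lam i)) := by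
    have hrange : Finset.range (n + 1) =
        insert 0 (Finset.Icc 1 M ∪ Finset.Icc (M + 1) n) := by
      ext i
      simp only [Finset.mem_range, Finset.mem_insert, Finset.mem_union, Finset.mem_Icc]
      omega
    have hdisj : Disjoint (Finset.Icc 1 M) (Finset.Icc (M + 1) n) := by
      rw [Finset.disjoint_left]
      intro i
      simp only [Finset.mem_Icc]
      omega
    rw [hQc, hrange, Finset.prod_insert (by simp), Finset.prod_union hdisj, ← hblocks,
      ← prod_Icc_one_min_mul M S fun i => X - C (lam i),
      ← prod_Icc_one_min_mul S M fun j => ∏ i ∈ Λ j, (X - C (lam i)), min_comm S M,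
      Finset.prod_mul_distrib]
    ring
  -- The order of the matrix is read off from the degree of its characteristic polynomial.
  obtain rfl : m = n + 1 := by
    have h := congrArg natDegree hchar
    rwa [charpoly_natDegree_eq_dim, Fintype.card_fin, natDegree_prod_of_monic _ _
      fun i _ => monic_X_sub_C _, Finset.sum_congr rfl fun i _ => natDegree_X_sub_C _,
      Finset.sum_const, Finset.card_range, smul_eq_mul, mul_one] at h
  exact ⟨Q, hQ0, hQb, hchar⟩
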